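/- For a group $G$ let the Ma-Qiu index $a(G)$ be the minimum number of elements whose normal closure in $G$ is the commutator subgroup $[G,G]$, and let the Nakanishi index $m(G)$ be the minimum number of generators of the Alexander module of $G$, that is, of $[G,G]/[[G,G],[G,G]]$ as a module over $\mathbb{Z}[G/[G,G]]$, where $G/[G,G]$ acts by conjugation (both indices are $\infty$ if there is no finite generating set). For a virtual or welded knot $K$ let $G(K)$ be its knot group, the group given by the Wirtinger presentation of a diagram of $K$ (virtual crossings being ignored), and put $a(K)=a(G(K))$, $m(K)=m(G(K))$; the claim below holds for the Wirtinger group of every diagram of $K$. A virtualization replaces one classical crossing of a diagram by a virtual crossing; a crossing change exchanges the over and under strands at one classical crossing. For integers $m,n\ge 0$, a diagram is $(m,n)$-unknottable if applying $m$ virtualizations and $n$ crossing changes to it, in some order, yields a diagram of the trivial knot, in the virtual sense if $K$ is a virtual knot and in the welded sense if $K$ is a welded knot. **Corollary.** Let $K$ be a virtual or welded knot that admits an $(m,n)$-unknottable diagram. Then $$m(K)\le a(K)\le m+n .$$ -/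

import Mathlib

namespace VirtualKnot

/-! ### The Ma-Qiu index and the Nakanishi index of a group -/

section Indices

/-- The Ma-Qiu index `a(G)`: the minimum number of normal generators of the commutator subgroup
(`⊤` if no finite set normally generates it). -/
noncomputable def maQiuIndex (G : Type*) [Group G] : ℕ∞ :=
  ⨅ S : {S : Set G // Subgroup.normalClosure S = commutator G}, S.1.encard

/-- The conjugation action of `G` on `[G,G] / [[G,G],[G,G]]`. -/
def conjAction (G : Type*) [Group G] :
    G →* Monoid.End (Abelianization (commutator G)) where
  toFun g := Abelianization.map (MulAut.conjNormal g : MulAut (commutator G)).toMonoidHom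
  map_one' := by
    apply Abelianization.hom_ext
    ext x
    simp
    rfl
  map_mul' g h := by
    apply Abelianization.hom_ext
    ext x
    simp
    rfl

/-- Elements of `[G,G]` act trivially on `[G,G] / [[G,G],[G,G]]`. -/
theorem conjAction_eq_one {G : Type*} [Group G] (c : G) (hc : c ∈ commutator G) :
    conjAction G c = 1 := by
  apply Abelianization.hom_ext
  ext x
  have h : (MulAut.conjNormal c : MulAut (commutator G)) x = ⟨c, hc⟩ * x * ⟨c, hc⟩⁻¹ := by
    ext
    simp
  change Abelianization.of ((MulAut.conjNormal c : MulAut (commutator G)) x) = Abelianization.of x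
  rw [h, map_mul, map_mul, map_inv, mul_comm, inv_mul_cancel_left]

/-- The conjugation action of `G / [G,G]` on `[G,G] / [[G,G],[G,G]]`. -/
def abelianizedAction (G : Type*) [Group G] :
    Abelianization G →* Monoid.End (Abelianization (commutator G)) :=
  QuotientGroup.lift (commutator G) (conjAction G) conjAction_eq_one

/-- The conjugation action as an integral representation of `G / [G,G]`. -/
def alexanderRep (G : Type*) [Group G] :
    Representation ℤ (Abelianization G) (Additive (Abelianization (commutator G))) where
  toFun g := (MonoidHom.toAdditive (abelianizedAction G g)).toIntLinearMap
  map_one' := by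
    ext x
    simp
    rfl
  map_mul' g h := by
    ext x
    simp
    rfl

/-- The Alexander module of `G`: the abelian group `[G,G] / [[G,G],[G,G]]` as a module over the
group ring `ℤ[G / [G,G]]`. -/
abbrev AlexanderModule (G : Type*) [Group G] : Type _ := (alexanderRep G).asModule

/-- The Nakanishi index `m(G)`: the minimum number of generators of the Alexander module over
`ℤ[G / [G,G]]` (`⊤` if it is not finitely generated). -/
noncomputable def nakanishiIndex (G : Type*) [Group G] : ℕ∞ :=
  ⨅ S : {S : Set (AlexanderModule G) //
    Submodule.span (MonoidAlgebra ℤ (Abelianization G)) S = ⊤}, S.1.encard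

end Indices

/-! ### Virtual knot diagrams

An oriented virtual knot diagram is a generic closed curve on the sphere each of whose double
points is a classical crossing (with over/under information) or a virtual crossing. We record it,
up to isotopy of the sphere, by the sequence of passages met while traversing the curve once from
some base point. -/

/-- How the curve passes through a double point: as the over strand or the under strand of a
classical crossing, or through a virtual crossing. -/
inductive Passage
  | over
  | under
  | virt
  deriving DecidableEq

/-- The kind of the other passage through the same double point. -/
def Passage.dual : Passage → Passage
  | .over => .under
  | .under => .over
  | .virt => .virt

/-- One passage of the curve through a double point. `label` names the double point. `side` is `1`
if the other strand crosses the current one from its right to its left, and `-1` if it crosses from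
left to right. -/
structure Letter where
  label : ℕ
  passage : Passage
  side : ℤˣ
  deriving DecidableEq

/-- The other passage through the same double point. -/
def Letter.opposite (l : Letter) : Letter := ⟨l.label, l.passage.dual, -l.side⟩

/-- Rename the double points. -/
def Letter.relabel (f : Equiv.Perm ℕ) (l : Letter) : Letter := ⟨f l.label, l.passage, l.side⟩

/-- Exchange over and under at the double point `k`. -/
def Letter.changeAt (k : ℕ) (l : Letter) : Letter :=
  if l.label = k then ⟨l.label, l.passage.dual, l.side⟩ else l

/-- Make the double point `k` virtual. -/
def Letter.virtualizeAt (k : ℕ) (l : Letter) : Letter :=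
  if l.label = k then ⟨l.label, .virt, l.side⟩ else l

/-- Every double point that occurs is passed exactly twice, the two passages being opposite. -/
def IsGaussWord (w : List Letter) : Prop :=
  w.Nodup ∧ ∀ l ∈ w, l.opposite ∈ w ∧ ∀ l' ∈ w, l'.label = l.label → l' = l ∨ l' = l.opposite

/-- The semi-arcs of a word of length `n` are numbered `0, …, n`: the `i`-th letter is passed when
going from semi-arc `i` to semi-arc `i + 1`, and the semi-arcs `0` and `n` are two parts of the
same edge, separated by the base point. -/
abbrev SemiArc (w : List Letter) : Type := Fin (w.length + 1)

/-- The two sides of a semi-arc. -/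
inductive Side
  | left
  | right

/-- Adjacency of sides of semi-arcs across the base point and in the four corners at a double
point. In the corner rules the strand through position `j` crosses the strand through position `i`
from right to left. -/
inductive SameRegion (w : List Letter) : SemiArc w × Side → SemiArc w × Side → Prop
  | base (s : Side) : SameRegion w (0, s) (Fin.last w.length, s)
  | frontLeft (i j : Fin w.length) (h : w.get j = (w.get i).opposite) (hi : (w.get i).side = 1) :
      SameRegion w (i.succ, .left) (j.succ, .right)
  | backLeft (i j : Fin w.length) (h : w.get j = (w.get i).opposite) (hi : (w.get i).side = 1) :
      SameRegion w (i.castSucc, .left) (j.succ, .left)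
  | backRight (i j : Fin w.length) (h : w.get j = (w.get i).opposite) (hi : (w.get i).side = 1) :
      SameRegion w (i.castSucc, .right) (j.castSucc, .left)
  | frontRight (i j : Fin w.length) (h : w.get j = (w.get i).opposite) (hi : (w.get i).side = 1) :
      SameRegion w (i.succ, .right) (j.castSucc, .right)

/-- The complementary regions of the curve: sides of semi-arcs up to adjacency (`Quot` divides by
the equivalence relation generated by the given one). -/
abbrev Region (w : List Letter) : Type := Quot (SameRegion w)

/-- The word is the word of a curve on the sphere: by Euler's formula for a connected four-valent
graph, the number of regions exceeds the number of double points by two. -/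
def IsPlanar (w : List Letter) : Prop :=
  Nat.card (Region w) = (w.map Letter.label).toFinset.card + 2

/-- Virtual knot diagrams. -/
structure Diagram where
  word : List Letter
  isGaussWord : IsGaussWord word
  isPlanar : IsPlanar word

/-- The diagram without double points. -/
def Diagram.circle : Diagram where
  word := []
  isGaussWord := by simp [IsGaussWord]
  isPlanar := by
    have e : Region [] ≃ Bool :=
      { toFun := Quot.lift (fun x => match x.2 with | .left => true | .right => false) (by
          rintro _ _ (_ | ⟨i, _⟩ | ⟨i, _⟩ | ⟨i, _⟩ | ⟨i, _⟩)
          · rfl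
          all_goals exact i.elim0)
        invFun := fun b => Quot.mk _ (0, if b then .left else .right)
        left_inv := by
          rintro ⟨x, s⟩
          obtain rfl : x = 0 := Subsingleton.elim (α := Fin 1) _ _
          cases s <;> rfl
        right_inv := by rintro (_ | _) <;> rfl }
    simp [IsPlanar, Nat.card_congr e]

/-! ### Reidemeister moves, virtual and welded knots -/

/-- The two theories: virtual knots and welded knots. -/
inductive Flavor
  | virtual
  | welded

/-- The two letters `x`, `y` in the order determined by a sign. -/
def ordered (s : ℤˣ) (x y : Letter) : List Letter := if s = 1 then [x, y] else [y, x]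

/-- Which triangle moves are allowed. Here `p` is how one strand passes at its double points with
the two other strands, and `q` is how one of these passes the other.
* `p` virtual: the virtual and the mixed third move (`q` is arbitrary);
* `p` and `q` both classical: the third Reidemeister move;
* `p` over and `q` virtual: the strand moves over a virtual crossing, which is allowed for welded
  knots only.
Moving a strand under a virtual crossing is never allowed. -/
def TriangleAllowed (t : Flavor) (p q : Passage) : Prop :=
  p = .virt ∨ q ≠ .virt ∨ (t = .welded ∧ p = .over)

/-- The generalized Reidemeister moves on words (classical ones if the double points are classical,
virtual ones if they are virtual), together with renaming of the double points and change of the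
base point.

In the triangle move the strands 1, 2, 3 meet in the double points `a` (of 1 and 2), `b`
(of 1 and 3) and `c` (of 2 and 3). For straight strands with directions `d₁, d₂, d₃`, put
`α = sgn det(d₁, d₂)`, `β = sgn det(d₁, d₃)`, `γ = sgn det(d₂, d₃)`; then for one common sign `η`,
depending on which side of strand 1 the point `c` lies, the order of the double points is given by
the sign `η α β` on strand 1, by `η α γ` on strand 2 and by `η β γ` on strand 3. The move replaces
`η` by `-η`. Up to the base point the three strands are traversed in the order 1, 2, 3 or in the
order 1, 3, 2. -/
inductive WordMove (t : Flavor) : List Letter → List Letter → Prop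
  | rotate (u v : List Letter) : WordMove t (u ++ v) (v ++ u)
  | relabel (f : Equiv.Perm ℕ) (u : List Letter) : WordMove t u (u.map (Letter.relabel f))
  | kink (l : Letter) (u : List Letter) : WordMove t ([l, l.opposite] ++ u) u
  | bigonParallel (a b : ℕ) (p : Passage) (s : ℤˣ) (u v : List Letter) :
      WordMove t
        ([⟨a, p, s⟩, ⟨b, p, -s⟩] ++ u ++ [⟨a, p.dual, -s⟩, ⟨b, p.dual, s⟩] ++ v)
        (u ++ v)
  | bigonAntiparallel (a b : ℕ) (p : Passage) (s : ℤˣ) (u v : List Letter) :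
      WordMove t
        ([⟨a, p, s⟩, ⟨b, p, -s⟩] ++ u ++ [⟨b, p.dual, s⟩, ⟨a, p.dual, -s⟩] ++ v)
        (u ++ v)
  | triangle (a b c : ℕ) (p q : Passage) (α β γ η : ℤˣ) (u v w : List Letter)
      (h : TriangleAllowed t p q) :
      WordMove t
        (ordered (η * α * β) ⟨a, p, α⟩ ⟨b, p, β⟩ ++ u ++
          ordered (η * α * γ) ⟨a, p.dual, -α⟩ ⟨c, q, γ⟩ ++ v ++
          ordered (η * β * γ) ⟨b, p.dual, -β⟩ ⟨c, q.dual, -γ⟩ ++ w)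
        (ordered (-η * α * β) ⟨a, p, α⟩ ⟨b, p, β⟩ ++ u ++
          ordered (-η * α * γ) ⟨a, p.dual, -α⟩ ⟨c, q, γ⟩ ++ v ++
          ordered (-η * β * γ) ⟨b, p.dual, -β⟩ ⟨c, q.dual, -γ⟩ ++ w)
  | triangle' (a b c : ℕ) (p q : Passage) (α β γ η : ℤˣ) (u v w : List Letter)
      (h : TriangleAllowed t p q) :
      WordMove t
        (ordered (η * α * β) ⟨a, p, α⟩ ⟨b, p, β⟩ ++ u ++
          ordered (η * β * γ) ⟨b, p.dual, -β⟩ ⟨c, q.dual, -γ⟩ ++ v ++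
          ordered (η * α * γ) ⟨a, p.dual, -α⟩ ⟨c, q, γ⟩ ++ w)
        (ordered (-η * α * β) ⟨a, p, α⟩ ⟨b, p, β⟩ ++ u ++
          ordered (-η * β * γ) ⟨b, p.dual, -β⟩ ⟨c, q.dual, -γ⟩ ++ v ++
          ordered (-η * α * γ) ⟨a, p.dual, -α⟩ ⟨c, q, γ⟩ ++ w)

/-- A generalized Reidemeister move between diagrams. -/
def Diagram.Move (t : Flavor) (D E : Diagram) : Prop := WordMove t D.word E.word

/-- Virtual (respectively welded) knots: diagrams up to the equivalence relation generated by the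
generalized Reidemeister moves. -/
def Knot (t : Flavor) : Type := Quot (Diagram.Move t)

/-- The virtual (respectively welded) knot represented by a diagram. -/
def Diagram.knot (t : Flavor) (D : Diagram) : Knot t := Quot.mk _ D

/-- The trivial knot. -/
def Knot.trivial (t : Flavor) : Knot t := Diagram.circle.knot t

/-! ### The knot group -/

/-- The Wirtinger relators, with one generator for each semi-arc. The generator does not change at
the base point, along an over passage, and through a virtual crossing. At an under passage it is
conjugated by the generator of the over strand, according to the sign of the crossing (which is the
`side` of its over passage). -/
inductive Diagram.WirtingerRelator (D : Diagram) : FreeGroup (SemiArc D.word) → Prop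
  | base : D.WirtingerRelator
      (FreeGroup.of 0 * (FreeGroup.of (Fin.last D.word.length))⁻¹)
  | through (i : Fin D.word.length) (h : (D.word.get i).passage ≠ .under) :
      D.WirtingerRelator (FreeGroup.of i.succ * (FreeGroup.of i.castSucc)⁻¹)
  | crossing (i j : Fin D.word.length) (hi : (D.word.get i).passage = .under)
      (hj : D.word.get j = (D.word.get i).opposite) :
      D.WirtingerRelator
        (FreeGroup.of i.succ *
          (FreeGroup.of j.castSucc ^ (-((D.word.get j).side : ℤ)) * FreeGroup.of i.castSucc *
            FreeGroup.of j.castSucc ^ ((D.word.get j).side : ℤ))⁻¹)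

/-- The knot group, given by the Wirtinger presentation of the diagram. -/
abbrev Diagram.group (D : Diagram) : Type := PresentedGroup {r | D.WirtingerRelator r}

/-! ### Crossing changes and virtualizations -/

/-- `k` is a classical crossing of the diagram. -/
def Diagram.IsClassicalCrossing (D : Diagram) (k : ℕ) : Prop :=
  ∃ l ∈ D.word, l.label = k ∧ l.passage ≠ .virt

/-- `E` arises from `D` by a crossing change at one classical crossing. -/
def Diagram.CrossingChange (D E : Diagram) : Prop :=
  ∃ k, D.IsClassicalCrossing k ∧ E.word = D.word.map (Letter.changeAt k)

/-- `E` arises from `D` by replacing one classical crossing with a virtual crossing. -/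
def Diagram.Virtualization (D E : Diagram) : Prop :=
  ∃ k, D.IsClassicalCrossing k ∧ E.word = D.word.map (Letter.virtualizeAt k)

/-- `D` is `(m,n)`-unknottable: `m` virtualizations and `n` crossing changes, in some order,
convert `D` to a diagram of the trivial knot. -/
inductive Diagram.Unknottable (t : Flavor) : ℕ → ℕ → Diagram → Prop
  | trivial (D : Diagram) (h : D.knot t = Knot.trivial t) : Unknottable t 0 0 D
  | virtualize (m n : ℕ) (D E : Diagram) (h : D.Virtualization E) (hE : Unknottable t m n E) :
      Unknottable t (m + 1) n D
  | change (m n : ℕ) (D E : Diagram) (h : D.CrossingChange E) (hE : Unknottable t m n E) :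
      Unknottable t m (n + 1) D

end VirtualKnot

/-!
The inequality `m(G) ≤ a(G)` holds for every group: if `S` normally generates `[G,G]`, then `[G,G]`
is generated by the conjugates `g s g⁻¹` with `s ∈ S`, and the class of such a conjugate in
`[G,G] / [[G,G],[G,G]]` is the translate of the class of `s` by the class of `g`
(`nakanishiIndex_le_maQiuIndex`).

For `a(K) ≤ m + n` it suffices that `a` grows by at most one when a virtualization or a crossing
change is undone, since the trivial knot has an abelian group. Let `x`, `y` be the Wirtinger
generators of the two under semi-arcs at the crossing in question and `z` that of the over strand.
Then `y = z⁻ˢ x zˢ`, so `y x⁻¹` lies in `[G,G]`, and killing it costs at most one in `a`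
(`maQiuIndex_le_quotient_add_one`). In the quotient `Q` the elements `x = y` and `z` commute, so the
relations of the modified diagram hold in `Q` as well. Hence the group of the modified diagram maps
onto `Q`, and `a` does not increase under surjections
(`Diagram.maQiuIndex_le_of_modify_crossing`).

It remains to show that the knot group is an invariant. A homomorphism from the knot group to a
group `H` is a colouring of the diagram: the colour of the base point together with the colours of
the over strands at the crossings, subject to conditions met while traversing the word once. The
conditions for a concatenation of words split (`path_append`), so each move is checked on the
letters it affects: removing a kink or a bigon forgets colours that are forced, and a triangle move
conjugates the colour at one crossing by a power of the colour at another. By the argument of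
Yoneda's lemma (`Diagram.nonempty_mulEquiv`) these natural bijections between colourings give
isomorphisms of knot groups.
-/

namespace VirtualKnot

/-! ### Normal generation of the commutator subgroup -/

theorem maQiuIndex_le_of_surjective {G Q : Type*} [Group G] [Group Q] (π : G →* Q)
    (hπ : Function.Surjective π) : maQiuIndex Q ≤ maQiuIndex G := by
  refine le_iInf fun ⟨S, hS⟩ => ?_
  have h : Subgroup.normalClosure (π '' S) = commutator Q := by
    rw [← Subgroup.map_normalClosure S π hπ, hS, commutator_def, commutator_def,
      Subgroup.map_commutator, Subgroup.map_top_of_surjective π hπ]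
  exact (iInf_le _ (⟨π '' S, h⟩ : {S : Set Q // Subgroup.normalClosure S = commutator Q})).trans
    (Set.encard_image_le _ _)

theorem maQiuIndex_congr {G H : Type*} [Group G] [Group H] (e : G ≃* H) :
    maQiuIndex G = maQiuIndex H :=
  le_antisymm (maQiuIndex_le_of_surjective e.symm.toMonoidHom e.symm.surjective)
    (maQiuIndex_le_of_surjective e.toMonoidHom e.surjective)

theorem maQiuIndex_eq_zero {G : Type*} [Group G] (h : commutator G = ⊥) : maQiuIndex G = 0 := by
  have h' : Subgroup.normalClosure (∅ : Set G) = commutator G := by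
    rw [h, Subgroup.normalClosure_empty]
  exact le_antisymm ((iInf_le _ (⟨∅, h'⟩ :
    {S : Set G // Subgroup.normalClosure S = commutator G})).trans (by simp)) bot_le

/-- Normal generators of the commutator subgroup of `G / ⟨⟨r⟩⟩` lift to elements of `[G,G]`, which
together with `r` normally generate `[G,G]`. -/
theorem maQiuIndex_le_quotient_add_one {G : Type*} [Group G] (r : G) (hr : r ∈ commutator G) :
    maQiuIndex G ≤ maQiuIndex (G ⧸ Subgroup.normalClosure {r}) + 1 := by
  set N := Subgroup.normalClosure {r} with hN
  set π := QuotientGroup.mk' N with hπ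
  have hsurj : Function.Surjective π := QuotientGroup.mk'_surjective N
  have hcomm : (commutator G).map π = commutator (G ⧸ N) := by
    rw [commutator_def, commutator_def, Subgroup.map_commutator,
      Subgroup.map_top_of_surjective π hsurj]
  rw [maQiuIndex, maQiuIndex, ENat.iInf_add]
  refine le_iInf fun ⟨S, hS⟩ => ?_
  have hlift : ∀ s ∈ S, ∃ g ∈ commutator G, π g = s := by
    intro s hs
    have : s ∈ commutator (G ⧸ N) := hS ▸ Subgroup.subset_normalClosure hs
    rw [← hcomm] at this
    exact this
  choose! σ hσ hπσ using hlift
  have hcl : Subgroup.normalClosure (insert r (σ '' S)) = commutator G := by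
    apply le_antisymm
    · refine Subgroup.normalClosure_le_normal (Set.insert_subset hr ?_)
      rintro _ ⟨s, hs, rfl⟩
      exact hσ s hs
    · have hker : N ≤ Subgroup.normalClosure (insert r (σ '' S)) :=
        Subgroup.normalClosure_mono (by simp)
      have him : π '' (insert r (σ '' S)) ⊇ S := by
        intro s hs
        exact ⟨σ s, Set.mem_insert_of_mem _ ⟨s, hs, rfl⟩, hπσ s hs⟩
      have hmap : (commutator G).map π ≤
          (Subgroup.normalClosure (insert r (σ '' S))).map π := by
        rw [hcomm, ← hS, Subgroup.map_normalClosure _ π hsurj]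
        exact Subgroup.normalClosure_mono him
      rw [Subgroup.map_le_map_iff, hπ, QuotientGroup.ker_mk', sup_eq_left.2 hker] at hmap
      exact hmap
  refine (iInf_le _ (⟨_, hcl⟩ :
    {S : Set G // Subgroup.normalClosure S = commutator G})).trans ?_
  exact (Set.encard_insert_le _ _).trans (by gcongr; exact Set.encard_image_le _ _)

/-- The classes of normal generators of `[G,G]` generate the Alexander module, because a conjugate
`g s g⁻¹` represents the translate of the class of `s` by the class of `g`. -/
theorem nakanishiIndex_le_maQiuIndex (G : Type*) [Group G] :
    nakanishiIndex G ≤ maQiuIndex G := by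
  refine le_iInf fun ⟨S, hS⟩ => ?_
  have hmem : ∀ s ∈ S, s ∈ commutator G := fun s hs => hS ▸ Subgroup.subset_normalClosure hs
  let q : commutator G → AlexanderModule G := fun x =>
    (alexanderRep G).asModuleEquiv.symm (Additive.ofMul (Abelianization.of x))
  have hq_one : q 1 = 0 := by simp [q]
  have hq_mul : ∀ x y, q (x * y) = q x + q y := by intro x y; simp [q]
  have hq_inv : ∀ x, q x⁻¹ = -q x := by intro x; simp [q]
  let T : Set (AlexanderModule G) := (fun s : S => q ⟨s, hmem s s.2⟩) '' Set.univ
  have hT : Submodule.span (MonoidAlgebra ℤ (Abelianization G)) T = ⊤ := by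
    set P := Submodule.span (MonoidAlgebra ℤ (Abelianization G)) T
    have key : ∀ x (hx : x ∈ Subgroup.normalClosure S), ∃ hx' : x ∈ commutator G,
        q ⟨x, hx'⟩ ∈ P := by
      intro x hx
      refine Subgroup.closure_induction ?_ ?_ ?_ ?_ hx
      · intro x hx
        obtain ⟨s, hs, hsx⟩ := Group.mem_conjugatesOfSet_iff.1 hx
        obtain ⟨g, rfl⟩ := isConj_iff.1 hsx
        refine ⟨Subgroup.Normal.conj_mem inferInstance _ (hmem s hs) g, ?_⟩
        have : q ⟨g * s * g⁻¹, Subgroup.Normal.conj_mem inferInstance _ (hmem s hs) g⟩ =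
            MonoidAlgebra.of ℤ _ (Abelianization.of g) • q ⟨s, hmem s hs⟩ := by
          apply (alexanderRep G).asModuleEquiv.injective
          rw [MonoidAlgebra.of_apply, Representation.asModuleEquiv_map_smul,
            Representation.asAlgebraHom_single_one]
          rfl
        rw [this]
        exact P.smul_mem _ (Submodule.subset_span ⟨⟨s, hs⟩, trivial, rfl⟩)
      · exact ⟨one_mem _, by
          rw [show (⟨1, one_mem _⟩ : commutator G) = 1 from rfl, hq_one]
          exact P.zero_mem⟩
      · rintro x y - - ⟨hx, hx'⟩ ⟨hy, hy'⟩
        refine ⟨mul_mem hx hy, ?_⟩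
        rw [show (⟨x * y, mul_mem hx hy⟩ : commutator G) = ⟨x, hx⟩ * ⟨y, hy⟩ from rfl, hq_mul]
        exact P.add_mem hx' hy'
      · rintro x - ⟨hx, hx'⟩
        refine ⟨inv_mem hx, ?_⟩
        rw [show (⟨x⁻¹, inv_mem hx⟩ : commutator G) = ⟨x, hx⟩⁻¹ from rfl, hq_inv]
        exact P.neg_mem hx'
    rw [eq_top_iff]
    intro v _
    obtain ⟨x, hx⟩ := QuotientGroup.mk_surjective
      (Additive.toMul ((alexanderRep G).asModuleEquiv v) : Abelianization (commutator G))
    have hv : v = q x := by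
      apply (alexanderRep G).asModuleEquiv.injective
      exact (congrArg Additive.ofMul hx).symm
    rw [hv]
    exact (key x.1 (by rw [hS]; exact x.2)).2
  refine (iInf_le _ (⟨T, hT⟩ : {S : Set (AlexanderModule G) //
    Submodule.span (MonoidAlgebra ℤ (Abelianization G)) S = ⊤})).trans ?_
  exact (Set.encard_image_le _ _).trans (by rw [Set.encard_univ, Set.encard])

/-! ### Crossing changes and virtualizations -/

/-- The Wirtinger generator of a semi-arc in the knot group. -/
def Diagram.gen (D : Diagram) (i : SemiArc D.word) : D.group := PresentedGroup.of i

theorem Diagram.gen_last (D : Diagram) : D.gen (Fin.last _) = D.gen 0 := by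
  have h := PresentedGroup.one_of_mem (rels := {r | D.WirtingerRelator r}) .base
  rw [map_mul, map_inv] at h
  exact (mul_inv_eq_one.1 h).symm

theorem Diagram.gen_through (D : Diagram) (i : Fin D.word.length)
    (h : (D.word.get i).passage ≠ .under) : D.gen i.succ = D.gen i.castSucc := by
  have h := PresentedGroup.one_of_mem (rels := {r | D.WirtingerRelator r}) (.through i h)
  rw [map_mul, map_inv] at h
  exact mul_inv_eq_one.1 h

theorem Diagram.gen_crossing (D : Diagram) (i j : Fin D.word.length)
    (hi : (D.word.get i).passage = .under) (hj : D.word.get j = (D.word.get i).opposite) :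
    D.gen i.succ = D.gen j.castSucc ^ (-((D.word.get j).side : ℤ)) * D.gen i.castSucc *
      D.gen j.castSucc ^ ((D.word.get j).side : ℤ) := by
  have h := PresentedGroup.one_of_mem (rels := {r | D.WirtingerRelator r}) (.crossing i j hi hj)
  rw [map_mul, map_inv] at h
  have h := mul_inv_eq_one.1 h
  simp only [map_mul, map_zpow] at h
  exact h

/-- A labelling of the semi-arcs that satisfies the Wirtinger relations extends to the knot
group. -/
theorem Diagram.exists_hom (D : Diagram) {H : Type*} [Group H] (c : SemiArc D.word → H)
    (h0 : c 0 = c (Fin.last _))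
    (h1 : ∀ i : Fin D.word.length, (D.word.get i).passage ≠ .under → c i.succ = c i.castSucc)
    (h2 : ∀ i j : Fin D.word.length, (D.word.get i).passage = .under →
      D.word.get j = (D.word.get i).opposite →
      c i.succ = c j.castSucc ^ (-((D.word.get j).side : ℤ)) * c i.castSucc *
        c j.castSucc ^ ((D.word.get j).side : ℤ)) :
    ∃ φ : D.group →* H, ∀ i, φ (D.gen i) = c i := by
  refine ⟨PresentedGroup.toGroup (f := c) ?_, fun i => PresentedGroup.toGroup.of _⟩
  rintro _ (_ | ⟨i, hi⟩ | ⟨i, j, hi, hj⟩)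
  · simp [h0]
  · simp [h1 i hi]
  · simp only [map_mul, map_inv, map_zpow, FreeGroup.lift_apply_of]
    rw [h2 i j hi hj, mul_inv_cancel]

theorem Diagram.hom_ext {D : Diagram} {H : Type*} [Group H] {φ ψ : D.group →* H}
    (h : ∀ i, φ (D.gen i) = ψ (D.gen i)) : φ = ψ :=
  PresentedGroup.ext h

theorem Letter.label_opposite (l : Letter) : l.opposite.label = l.label := rfl

/-- Suppose that a homomorphism `π` on the knot group of `D` identifies the two under semi-arcs at
the crossing `k`. Then the colours of the two strands at `k` commute, so all relations which can be
imposed at `k` hold for the images of the generators. -/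
theorem Diagram.exists_hom_of_modify_crossing (D E : Diagram) (k : ℕ) (g : Letter → Letter)
    (hg : ∀ l, l.label ≠ k → g l = l) (hlabel : ∀ l, (g l).label = l.label)
    (hE : E.word = D.word.map g) {Q : Type*} [Group Q] (π : D.group →* Q)
    (hπ : ∀ i : Fin D.word.length, (D.word.get i).label = k →
      π (D.gen i.succ) = π (D.gen i.castSucc))
    (hcomm : ∀ i j : Fin D.word.length, (D.word.get i).label = k → (D.word.get j).label = k →
      Commute (π (D.gen i.castSucc)) (π (D.gen j.castSucc))) :
    ∃ φ : E.group →* Q, π.range ≤ φ.range := by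
  have hlen : E.word.length = D.word.length := by rw [hE, List.length_map]
  have hget : ∀ i : Fin E.word.length, E.word.get i = g (D.word.get (i.cast hlen)) := by
    intro i
    simp [hE]
  have hex : ∃ φ : E.group →* Q, ∀ i, φ (E.gen i) =
      π (D.gen (i.cast (congrArg (· + 1) hlen))) := by
    refine E.exists_hom (fun i => π (D.gen (i.cast (congrArg (· + 1) hlen)))) ?_ ?_ ?_
    · have hzero : (0 : SemiArc E.word).cast (congrArg (· + 1) hlen) = (0 : SemiArc D.word) :=
        Fin.ext rfl
      have hlast : (Fin.last E.word.length).cast (congrArg (· + 1) hlen) =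
          Fin.last D.word.length := Fin.ext hlen
      exact congrArg π ((congrArg D.gen hzero).trans
        (D.gen_last.symm.trans (congrArg D.gen hlast.symm)))
    · intro i hi
      rw [hget] at hi
      by_cases hk : (D.word.get (i.cast hlen)).label = k
      · exact hπ _ hk
      · rw [hg _ hk] at hi
        exact congrArg π (D.gen_through _ hi)
    · intro i j hi hj
      have hl : (D.word.get (j.cast hlen)).label = (D.word.get (i.cast hlen)).label := by
        have := congrArg Letter.label hj
        rwa [Letter.label_opposite, hget, hget, hlabel, hlabel] at this
      by_cases hk : (D.word.get (i.cast hlen)).label = k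
      -- The relation conjugates the colour of `i` by a colour that commutes with it.
      · have h1 := hπ (i.cast hlen) hk
        have h2 := hcomm (i.cast hlen) (j.cast hlen) hk (hl.trans hk)
        refine h1.trans ?_
        rw [mul_assoc]
        have := (h2.zpow_right ((E.word.get j).side : ℤ)).eq
        erw [this]
        simp
      · rw [hget, hg _ hk] at hi
        rw [hget, hget, hg _ hk, hg _ (hl ▸ hk)] at hj
        have := congrArg π (D.gen_crossing _ _ hi hj)
        rw [hget, hg _ (hl ▸ hk)]
        simp only [map_mul, map_zpow] at this
        exact this
  obtain ⟨φ, hφ⟩ := hex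
  refine ⟨φ, ?_⟩
  rw [MonoidHom.range_eq_map, ← PresentedGroup.closure_range_of, MonoidHom.map_closure,
    Subgroup.closure_le]
  rintro _ ⟨_, ⟨i, rfl⟩, rfl⟩
  exact ⟨E.gen (i.cast (congrArg (· + 1) hlen.symm)), hφ _⟩

theorem Letter.passage_opposite (l : Letter) : l.opposite.passage = l.passage.dual := rfl

theorem Letter.opposite_opposite (l : Letter) : l.opposite.opposite = l := by
  obtain ⟨k, _ | _ | _, s⟩ := l <;> simp [Letter.opposite, Passage.dual]

theorem conj_mul_inv_mem_commutator {G : Type*} [Group G] (x z : G) (s : ℤ) :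
    z ^ (-s) * x * z ^ s * x⁻¹ ∈ commutator G := by
  have := Subgroup.commutator_mem_commutator (Subgroup.mem_top (z ^ (-s))) (Subgroup.mem_top x)
  rw [commutator_def]
  simpa [commutatorElement_def] using this

theorem commute_of_conj_zpow_eq {G : Type*} [Group G] {x z : G} {s : ℤˣ}
    (h : z ^ (-(s : ℤ)) * x * z ^ (s : ℤ) = x) : Commute x z := by
  have h' : x * z ^ (s : ℤ) = z ^ (s : ℤ) * x := by
    rw [zpow_neg, mul_assoc, inv_mul_eq_iff_eq_mul] at h
    exact h
  rcases Int.units_eq_one_or s with rfl | rfl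
  · rwa [Units.val_one, zpow_one] at h'
  · rw [Units.val_neg, Units.val_one, zpow_neg, zpow_one] at h'
    exact (Commute.inv_right_iff (a := x)).1 h'

/-- The quotient of the knot group of `D` in which the two under semi-arcs at `k` agree is also a
quotient of the knot group of any diagram that differs from `D` only at `k`. -/
theorem Diagram.maQiuIndex_le_of_modify_crossing (D E : Diagram) (k : ℕ) (g : Letter → Letter)
    (hk : D.IsClassicalCrossing k)
    (hg : ∀ l, l.label ≠ k → g l = l) (hlabel : ∀ l, (g l).label = l.label)
    (hE : E.word = D.word.map g) :
    maQiuIndex D.group ≤ maQiuIndex E.group + 1 := by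
  -- Name `u` the under passage and `v` the over passage at `k`.
  obtain ⟨u, v, hu, hv, huv⟩ : ∃ u v : Fin D.word.length, (D.word.get u).passage = .under ∧
      (D.word.get u).label = k ∧ D.word.get v = (D.word.get u).opposite := by
    obtain ⟨l, hl, hlk, hc⟩ := hk
    obtain ⟨i, rfl⟩ := List.mem_iff_get.1 hl
    obtain ⟨j, hj⟩ := List.mem_iff_get.1 (D.isGaussWord.2 _ hl).1
    rcases hp : (D.word.get i).passage with _ | _ | _
    · refine ⟨j, i, ?_, ?_, ?_⟩
      · rw [hj, Letter.passage_opposite, hp]; rfl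
      · rw [hj]; exact hlk
      · rw [hj, Letter.opposite_opposite]
    · exact ⟨i, j, hp, hlk, hj⟩
    · exact absurd hp hc
  have hall : ∀ i : Fin D.word.length, (D.word.get i).label = k → i = u ∨ i = v := by
    intro i hi
    rcases (D.isGaussWord.2 _ (List.get_mem _ u)).2 _ (List.get_mem _ i) (hi.trans hv.symm)
      with h | h
    · exact Or.inl ((D.isGaussWord.1.injective_get) h)
    · exact Or.inr ((D.isGaussWord.1.injective_get) (h.trans huv.symm))
  have hvover : (D.word.get v).passage ≠ .under := by
    rw [huv, Letter.passage_opposite, hu]; decide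
  set r := D.gen u.succ * (D.gen u.castSucc)⁻¹ with hr
  have hrc : r ∈ commutator D.group := by
    rw [hr, D.gen_crossing u v hu huv]
    exact conj_mul_inv_mem_commutator _ _ _
  refine (maQiuIndex_le_quotient_add_one r hrc).trans (add_le_add_left ?_ 1)
  set π := QuotientGroup.mk' (Subgroup.normalClosure {r}) with hπ
  have hπr : π (D.gen u.succ) = π (D.gen u.castSucc) := by
    rw [← mul_inv_eq_one, ← map_inv, ← map_mul]
    exact (QuotientGroup.eq_one_iff _).2 (Subgroup.subset_normalClosure rfl)
  have hc : Commute (π (D.gen u.castSucc)) (π (D.gen v.castSucc)) := by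
    have := congrArg π (D.gen_crossing u v hu huv)
    rw [hπr] at this
    simp only [map_mul, map_zpow] at this
    exact commute_of_conj_zpow_eq this.symm
  have hsame : ∀ i : Fin D.word.length, (D.word.get i).label = k →
      π (D.gen i.succ) = π (D.gen i.castSucc) := by
    intro i hi
    rcases hall i hi with rfl | rfl
    · exact hπr
    · exact congrArg π (D.gen_through _ hvover)
  have hcomm : ∀ i j : Fin D.word.length, (D.word.get i).label = k → (D.word.get j).label = k →
      Commute (π (D.gen i.castSucc)) (π (D.gen j.castSucc)) := by
    intro i j hi hj
    rcases hall i hi with rfl | rfl <;> rcases hall j hj with rfl | rfl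
    · exact Commute.refl _
    · exact hc
    · exact hc.symm
    · exact Commute.refl _
  obtain ⟨φ, hφ⟩ := D.exists_hom_of_modify_crossing E k g hg hlabel hE π hsame hcomm
  refine maQiuIndex_le_of_surjective φ ?_
  rw [← MonoidHom.range_eq_top, eq_top_iff]
  exact (MonoidHom.range_eq_top.2 (QuotientGroup.mk'_surjective _)).ge.trans hφ

theorem Diagram.CrossingChange.maQiuIndex_le {D E : Diagram} (h : D.CrossingChange E) :
    maQiuIndex D.group ≤ maQiuIndex E.group + 1 := by
  obtain ⟨k, hk, hE⟩ := h
  refine D.maQiuIndex_le_of_modify_crossing E k _ hk ?_ ?_ hE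
  · intro l hl
    simp [Letter.changeAt, hl]
  · intro l
    unfold Letter.changeAt
    split_ifs <;> rfl

theorem Diagram.Virtualization.maQiuIndex_le {D E : Diagram} (h : D.Virtualization E) :
    maQiuIndex D.group ≤ maQiuIndex E.group + 1 := by
  obtain ⟨k, hk, hE⟩ := h
  refine D.maQiuIndex_le_of_modify_crossing E k _ hk ?_ ?_ hE
  · intro l hl
    simp [Letter.virtualizeAt, hl]
  · intro l
    unfold Letter.virtualizeAt
    split_ifs <;> rfl

/-- The knot group of the diagram without double points has a single generator, hence is
abelian. -/
theorem maQiuIndex_circle : maQiuIndex Diagram.circle.group = 0 := by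
  have hcl : ∀ x : Diagram.circle.group, x ∈ Subgroup.zpowers (Diagram.circle.gen 0) := by
    intro x
    have : x ∈ Subgroup.closure (Set.range
        (PresentedGroup.of (rels := {r | Diagram.circle.WirtingerRelator r}))) := by
      rw [PresentedGroup.closure_range_of]; trivial
    refine (Subgroup.closure_le _).2 ?_ this
    rintro _ ⟨i, rfl⟩
    obtain rfl : i = 0 := Subsingleton.elim (α := Fin 1) _ _
    exact Subgroup.mem_zpowers _
  apply maQiuIndex_eq_zero
  rw [commutator_def, Subgroup.commutator_eq_bot_iff_le_centralizer]
  intro x _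
  rw [Subgroup.mem_centralizer_iff]
  intro y _
  obtain ⟨a, rfl⟩ := hcl x
  obtain ⟨b, rfl⟩ := hcl y
  exact (zpow_mul_comm _ _ _)

/-! ### Colourings of words -/

section Coloring

variable {H K : Type} [Group H] [Group K]

/-- The colour after a passage. Here `x` is the colour before it and `f k` is the colour of the
over strand at the crossing `k`; the `side` of an under passage is minus the sign of the
crossing. -/
def Letter.act (f : ℕ → H) (x : H) (l : Letter) : H :=
  if l.passage = .under then f l.label ^ (l.side : ℤ) * x * f l.label ^ (-(l.side : ℤ)) else x

/-- The colour after a sequence of passages. -/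
def run (f : ℕ → H) (x : H) (w : List Letter) : H := w.foldl (Letter.act f) x

/-- Starting with the colour `x` and traversing `w`, one arrives with the colour `y`, and at each
over passage of a crossing `k` the colour is `f k`. -/
def Path (f : ℕ → H) : H → List Letter → H → Prop
  | x, [], y => x = y
  | x, l :: w, y => (l.passage = .over → f l.label = x) ∧ Path f (l.act f x) w y

@[simp] theorem run_nil (f : ℕ → H) (x : H) : run f x [] = x := rfl

@[simp] theorem path_nil (f : ℕ → H) (x y : H) : Path f x [] y ↔ x = y := Iff.rfl

@[simp] theorem path_cons (f : ℕ → H) (x y : H) (l : Letter) (w : List Letter) :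
    Path f x (l :: w) y ↔ (l.passage = .over → f l.label = x) ∧ Path f (l.act f x) w y := Iff.rfl

theorem Path.run_eq {f : ℕ → H} {x y : H} {w : List Letter} (h : Path f x w y) :
    run f x w = y := by
  induction w generalizing x with
  | nil => exact h
  | cons l w ih => exact ih h.2

theorem path_append {f : ℕ → H} {x y : H} {u v : List Letter} :
    Path f x (u ++ v) y ↔ ∃ z, Path f x u z ∧ Path f z v y := by
  induction u generalizing x with
  | nil => simp
  | cons l u ih => simp [ih, and_assoc]

theorem run_append (f : ℕ → H) (x : H) (u v : List Letter) :
    run f x (u ++ v) = run f (run f x u) v := List.foldl_append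

/-- Only the colours of crossings that occur in the word matter. -/
theorem Path.congr {f g : ℕ → H} {x y : H} {w : List Letter} (h : Path f x w y)
    (hfg : ∀ l ∈ w, f l.label = g l.label) : Path g x w y := by
  induction w generalizing x with
  | nil => exact h
  | cons l w ih =>
    have hl := hfg l (by simp)
    refine ⟨fun ho => hl ▸ h.1 ho, ?_⟩
    have : l.act g x = l.act f x := by simp [Letter.act, hl]
    rw [this]
    exact ih h.2 fun l hl => hfg l (by simp [hl])

theorem run_congr {f g : ℕ → H} {w : List Letter}
    (hfg : ∀ l ∈ w, f l.label = g l.label) (x : H) : run f x w = run g x w := by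
  induction w generalizing x with
  | nil => rfl
  | cons l w ih =>
    have hl := hfg l (by simp)
    have : l.act g x = l.act f x := by simp [Letter.act, hl]
    change run f (l.act f x) w = run g (l.act g x) w
    rw [this]
    exact ih (fun l hl => hfg l (by simp [hl])) _

theorem Letter.map_act (φ : H →* K) (f : ℕ → H) (x : H) (l : Letter) :
    φ (l.act f x) = l.act (φ ∘ f) (φ x) := by
  unfold Letter.act
  split_ifs <;> simp

theorem map_run (φ : H →* K) (f : ℕ → H) (x : H) (w : List Letter) :
    φ (run f x w) = run (φ ∘ f) (φ x) w := by
  induction w generalizing x with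
  | nil => rfl
  | cons l w ih =>
    change φ (run f (l.act f x) w) = run _ (l.act _ _) w
    rw [ih, Letter.map_act]

theorem Path.map (φ : H →* K) {f : ℕ → H} {x y : H} {w : List Letter} (h : Path f x w y) :
    Path (φ ∘ f) (φ x) w (φ y) := by
  induction w generalizing x with
  | nil => exact congrArg φ h
  | cons l w ih =>
    refine ⟨fun ho => congrArg φ (h.1 ho), ?_⟩
    rw [← Letter.map_act]
    exact ih h.2

theorem path_iff {f : ℕ → H} {x y : H} {w : List Letter} :
    Path f x w y ↔ run f x w = y ∧ ∀ i : Fin w.length, (w.get i).passage = .over →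
      f (w.get i).label = run f x (w.take i) := by
  induction w generalizing x with
  | nil => simp
  | cons l w ih =>
    rw [path_cons, ih]
    constructor
    · rintro ⟨h1, h2, h3⟩
      refine ⟨h2, fun i => ?_⟩
      refine Fin.cases ?_ (fun i => ?_) i
      · exact h1
      · exact h3 i
    · rintro ⟨h2, h3⟩
      exact ⟨h3 ⟨0, by simp⟩, h2, fun i => h3 i.succ⟩

theorem run_take_succ (f : ℕ → H) (x : H) (w : List Letter) (i : Fin w.length) :
    run f x (w.take (i + 1)) = (w.get i).act f (run f x (w.take i)) := by
  rw [List.take_succ_eq_append_getElem i.2, run_append]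
  rfl

end Coloring

/-- Candidates for colourings: the colour of the base point and the colours of the over strands at
the crossings. -/
abbrev Coloring (H : Type) : Type := H × (ℕ → H)

/-- The image of a colouring under a homomorphism. -/
def Coloring.map {H K : Type} [Group H] [Group K] (φ : H →* K) (c : Coloring H) : Coloring K :=
  (φ c.1, φ ∘ c.2)

/-- The label `k` has an over passage in `w`. -/
def OverAt (w : List Letter) (k : ℕ) : Prop := ∃ l ∈ w, l.passage = .over ∧ l.label = k

/-- A colouring is admissible for `w` if the Wirtinger relations hold along `w`. The colours at
labels without an over passage are irrelevant; they are normalized to `1`. -/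
structure Coloring.IsValid {H : Type} [Group H] (c : Coloring H) (w : List Letter) : Prop where
  path : Path c.2 c.1 w c.1
  eq_one : ∀ k, ¬ OverAt w k → c.2 k = 1

theorem Coloring.IsValid.map {H K : Type} [Group H] [Group K] (φ : H →* K) {c : Coloring H}
    {w : List Letter} (h : c.IsValid w) : (c.map φ).IsValid w :=
  ⟨h.path.map φ, fun k hk => by simp [Coloring.map, h.eq_one k hk]⟩

/-- An admissible colouring of the word of `D` amounts to a homomorphism on the knot group. -/
theorem Coloring.IsValid.exists_hom {D : Diagram} {H : Type} [Group H] {c : Coloring H}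
    (h : c.IsValid D.word) :
    ∃ φ : D.group →* H, ∀ i, φ (D.gen i) = run c.2 c.1 (D.word.take i) := by
  obtain ⟨hrun, hover⟩ := path_iff.1 h.path
  refine D.exists_hom (fun i => run c.2 c.1 (D.word.take i)) ?_ ?_ ?_
  · simp [hrun]
  · intro i hi
    simp only [Fin.val_succ, Fin.val_castSucc]
    rw [run_take_succ, Letter.act, if_neg hi]
  · intro i j hi hj
    have hjo : (D.word.get j).passage = .over := by
      rw [hj, Letter.passage_opposite, hi]; rfl
    have hl : (D.word.get j).label = (D.word.get i).label := by rw [hj]; rfl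
    have hs : (D.word.get j).side = -(D.word.get i).side := by rw [hj]; rfl
    simp only [Fin.val_succ, Fin.val_castSucc]
    rw [run_take_succ, Letter.act, if_pos hi, ← hover j hjo, hl, hs]
    simp

/-- The tautological colouring with values in the knot group. -/
theorem Diagram.exists_universal_coloring (D : Diagram) :
    ∃ c : Coloring D.group, c.IsValid D.word ∧
      ∀ i : SemiArc D.word, run c.2 c.1 (D.word.take i) = D.gen i := by
  classical
  let f : ℕ → D.group := fun k =>
    if h : ∃ j : Fin D.word.length, (D.word.get j).passage = .over ∧ (D.word.get j).label = k
    then D.gen h.choose.castSucc else 1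
  have hf : ∀ j : Fin D.word.length, (D.word.get j).passage = .over →
      f (D.word.get j).label = D.gen j.castSucc := by
    intro j hj
    have h : ∃ j' : Fin D.word.length, (D.word.get j').passage = .over ∧
      (D.word.get j').label = (D.word.get j).label := ⟨j, hj, rfl⟩
    have hc := h.choose_spec
    have : h.choose = j := by
      apply D.isGaussWord.1.injective_get
      rcases (D.isGaussWord.2 _ (List.get_mem _ j)).2 _ (List.get_mem _ h.choose) hc.2 with e | e
      · exact e
      · have := hc.1
        rw [e] at this
        rw [Letter.passage_opposite, hj] at this
        exact absurd this (by decide)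
    simp only [f, dif_pos h, this]
  have hrun : ∀ i (hi : i < D.word.length + 1),
      run f (D.gen 0) (D.word.take i) = D.gen ⟨i, hi⟩ := by
    intro i
    induction i with
    | zero => intro _; rfl
    | succ i ih =>
      intro hi
      have hi' : i < D.word.length := by omega
      have := run_take_succ f (D.gen 0) D.word ⟨i, hi'⟩
      simp only at this
      rw [this, ih (by omega), Letter.act]
      split_ifs with hu
      · obtain ⟨j, hj⟩ := List.mem_iff_get.1 (D.isGaussWord.2 _ (List.get_mem _ ⟨i, hi'⟩)).1
        have hjo : (D.word.get j).passage = .over := by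
          rw [hj, Letter.passage_opposite, hu]; rfl
        have hl : (D.word.get j).label = (D.word.get ⟨i, hi'⟩).label := by rw [hj]; rfl
        have hs : (D.word.get j).side = -(D.word.get ⟨i, hi'⟩).side := by rw [hj]; rfl
        have := D.gen_crossing ⟨i, hi'⟩ j hu hj
        rw [hs] at this
        rw [← hl, hf j hjo]
        simp only [Units.val_neg, neg_neg] at this
        exact this.symm
      · exact (D.gen_through ⟨i, hi'⟩ hu).symm
  refine ⟨(D.gen 0, f), ⟨path_iff.2 ⟨?_, ?_⟩, ?_⟩, fun i => hrun i i.2⟩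
  · have := hrun D.word.length (by omega)
    rw [List.take_length] at this
    exact this.trans D.gen_last
  · intro i hi
    exact (hf i hi).trans (hrun i (by omega)).symm
  · intro k hk
    refine dif_neg ?_
    rintro ⟨j, hj, hjk⟩
    exact hk ⟨_, List.get_mem _ j, hj, hjk⟩

/-- Transformations of colourings, natural in the group, that send admissible colourings of `w` to
admissible colourings of `w'`. -/
structure ColoringMap (w w' : List Letter) where
  toFun : ∀ {H : Type} [Group H], Coloring H → Coloring H
  natural : ∀ {H K : Type} [Group H] [Group K] (φ : H →* K) (c : Coloring H),
    toFun (c.map φ) = (toFun c).map φ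
  valid : ∀ {H : Type} [Group H] (c : Coloring H), c.IsValid w → (toFun c).IsValid w'

/-- Naturally equivalent colourings give isomorphic knot groups, by the argument of Yoneda's
lemma. -/
theorem Diagram.nonempty_mulEquiv {D E : Diagram} (S : ColoringMap D.word E.word)
    (T : ColoringMap E.word D.word)
    (hTS : ∀ {H : Type} [Group H] (c : Coloring H), c.IsValid D.word → T.toFun (S.toFun c) = c)
    (hST : ∀ {H : Type} [Group H] (c : Coloring H), c.IsValid E.word → S.toFun (T.toFun c) = c) :
    Nonempty (D.group ≃* E.group) := by
  have ext : ∀ (D : Diagram) {H : Type} [Group H] {c d : Coloring H}, c.IsValid D.word →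
      d.IsValid D.word →
      (∀ i : SemiArc D.word, run c.2 c.1 (D.word.take i) = run d.2 d.1 (D.word.take i)) →
      c = d := by
    intro D H _ c d hc hd h
    refine Prod.ext (by simpa using h 0) (funext fun k => ?_)
    by_cases hk : OverAt D.word k
    · obtain ⟨l, hl, ho, rfl⟩ := hk
      obtain ⟨i, rfl⟩ := List.mem_iff_get.1 hl
      rw [(path_iff.1 hc.path).2 i ho, (path_iff.1 hd.path).2 i ho]
      exact h i.castSucc
    · rw [hc.eq_one k hk, hd.eq_one k hk]
  have hom : ∀ (D : Diagram) (c : Coloring D.group), c.IsValid D.word →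
      (∀ i : SemiArc D.word, run c.2 c.1 (D.word.take i) = D.gen i) →
      ∀ {H : Type} [Group H] (d : Coloring H), d.IsValid D.word →
      ∃ φ : D.group →* H, c.map φ = d := by
    intro D c hc hgen H _ d hd
    obtain ⟨φ, hφ⟩ := hd.exists_hom
    refine ⟨φ, ext D (hc.map φ) hd fun i => ?_⟩
    rw [← hφ, ← hgen i, map_run]
    rfl
  have endo : ∀ (D : Diagram) (c : Coloring D.group),
      (∀ i : SemiArc D.word, run c.2 c.1 (D.word.take i) = D.gen i) →
      ∀ φ : D.group →* D.group, c.map φ = c → φ = MonoidHom.id _ := by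
    intro D c hgen φ hφ
    apply Diagram.hom_ext
    intro i
    rw [← hgen i, map_run]
    exact congrArg (fun d : Coloring D.group => run d.2 d.1 (D.word.take i)) hφ
  have comp : ∀ {G H K : Type} [Group G] [Group H] [Group K] (φ : G →* H) (ψ : H →* K)
      (c : Coloring G), c.map (ψ.comp φ) = (c.map φ).map ψ := fun _ _ _ => rfl
  obtain ⟨c, hc, hcgen⟩ := D.exists_universal_coloring
  obtain ⟨d, hd, hdgen⟩ := E.exists_universal_coloring
  obtain ⟨φ, hφ⟩ := hom D c hc hcgen _ (T.valid d hd)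
  obtain ⟨ψ, hψ⟩ := hom E d hd hdgen _ (S.valid c hc)
  refine ⟨MonoidHom.toMulEquiv φ ψ (endo D c hcgen _ ?_) (endo E d hdgen _ ?_)⟩
  · rw [comp, hφ, ← T.natural, hψ, hTS c hc]
  · rw [comp, hψ, ← S.natural, hφ, hST d hd]

/-! ### Colourings under change of base point, relabelling, kinks and bigons -/

/-- The two words have naturally equivalent sets of admissible colourings. -/
def ColoringEquivalent (w w' : List Letter) : Prop :=
  ∃ (S : ColoringMap w w') (T : ColoringMap w' w),
    (∀ {H : Type} [Group H] (c : Coloring H), c.IsValid w → T.toFun (S.toFun c) = c) ∧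
    (∀ {H : Type} [Group H] (c : Coloring H), c.IsValid w' → S.toFun (T.toFun c) = c)

theorem OverAt.perm {w w' : List Letter} (h : w.Perm w') (k : ℕ) : OverAt w k ↔ OverAt w' k := by
  simp only [OverAt, h.mem_iff]

theorem IsGaussWord.perm {w w' : List Letter} (h : w.Perm w') (hw : IsGaussWord w) :
    IsGaussWord w' := by
  refine ⟨h.nodup_iff.1 hw.1, ?_⟩
  simpa only [h.mem_iff] using hw.2

/-- Once both passages through a double point occur in `P`, its label occurs nowhere else. -/
theorem IsGaussWord.label_ne {P R : List Letter} (hw : IsGaussWord (P ++ R)) {l : Letter}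
    (hl : l ∈ P) (hl' : l.opposite ∈ P) {m : Letter} (hm : m ∈ R) : m.label ≠ l.label := by
  intro h
  have hd := (List.nodup_append'.1 hw.1).2.2
  rcases (hw.2 l (List.mem_append_left _ hl)).2 m (List.mem_append_right _ hm) h with rfl | rfl
  · exact hd hl hm
  · exact hd hl' hm

theorem ColoringEquivalent.rotate (u v : List Letter) : ColoringEquivalent (u ++ v) (v ++ u) := by
  have val : ∀ (u v : List Letter) {H : Type} [Group H] (c : Coloring H), c.IsValid (u ++ v) →
      Coloring.IsValid (run c.2 c.1 u, c.2) (v ++ u) := by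
    intro u v H _ c hc
    obtain ⟨z, h1, h2⟩ := path_append.1 hc.path
    refine ⟨?_, fun k hk => hc.eq_one k ((OverAt.perm List.perm_append_comm k).not.1 hk)⟩
    rw [h1.run_eq]
    exact path_append.2 ⟨_, h2, h1⟩
  have nat : ∀ (u : List Letter) {H K : Type} [Group H] [Group K] (φ : H →* K) (c : Coloring H),
      (run (c.map φ).2 (c.map φ).1 u, (c.map φ).2) =
        Coloring.map φ (run c.2 c.1 u, c.2) := by
    intro u H K _ _ φ c
    exact Prod.ext (map_run φ _ _ _).symm rfl
  refine ⟨⟨fun c => (run c.2 c.1 u, c.2), nat u, val u v⟩,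
    ⟨fun c => (run c.2 c.1 v, c.2), nat v, val v u⟩, fun c hc => ?_, fun c hc => ?_⟩
  · exact Prod.ext ((run_append _ _ _ _).symm.trans hc.path.run_eq) rfl
  · exact Prod.ext ((run_append _ _ _ _).symm.trans hc.path.run_eq) rfl

theorem path_relabel {H : Type} [Group H] (σ : Equiv.Perm ℕ) {f : ℕ → H} {x y : H}
    {w : List Letter} : Path f x (w.map (Letter.relabel σ)) y ↔ Path (f ∘ σ) x w y := by
  induction w generalizing x with
  | nil => rfl
  | cons l w ih => exact and_congr Iff.rfl ih

theorem overAt_relabel (σ : Equiv.Perm ℕ) {w : List Letter} {k : ℕ} :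
    OverAt (w.map (Letter.relabel σ)) (σ k) ↔ OverAt w k := by
  simp [OverAt, Letter.relabel]

theorem ColoringEquivalent.relabel (σ : Equiv.Perm ℕ) (w : List Letter) :
    ColoringEquivalent w (w.map (Letter.relabel σ)) := by
  refine ⟨⟨fun c => (c.1, c.2 ∘ σ.symm), fun _ _ => rfl, fun c hc => ⟨?_, fun k hk => ?_⟩⟩,
    ⟨fun c => (c.1, c.2 ∘ σ), fun _ _ => rfl, fun c hc => ⟨?_, fun k hk => ?_⟩⟩,
    fun c _ => ?_, fun c _ => ?_⟩
  · rw [path_relabel]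
    simpa [Function.comp_assoc] using hc.path
  · refine hc.eq_one _ fun h => hk ?_
    simpa using (overAt_relabel σ).2 h
  · exact (path_relabel σ).1 hc.path
  · exact hc.eq_one _ fun h => hk ((overAt_relabel σ).1 h)
  · simp [Function.comp_assoc]
  · simp [Function.comp_assoc]

/-- A move that removes crossings with labels in `S` preserves colourings if the colours at the
removed crossings are forced to be the colour which is reached after the word `u`. -/
theorem ColoringEquivalent.remove {w w' : List Letter} (S : Finset ℕ) (u : List Letter)
    (hw' : ∀ l ∈ w', l.label ∉ S) (hu : ∀ l ∈ u, l.label ∉ S)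
    (hover : ∀ k, OverAt w k ↔ k ∈ S ∨ OverAt w' k)
    (hpath : ∀ {H : Type} [Group H] (f : ℕ → H) (x : H),
      Path f x w x ↔ (∀ k ∈ S, f k = run f x u) ∧ Path f x w' x) :
    ColoringEquivalent w w' := by
  let fill : ∀ {H : Type}, H → (ℕ → H) → ℕ → H := fun y f k => if k ∈ S then y else f k
  have hmem : ∀ {H : Type} (y : H) (f : ℕ → H) (k : ℕ), k ∈ S → fill y f k = y :=
    fun y f k hk => if_pos hk
  have hnot : ∀ {H : Type} (y : H) (f : ℕ → H) (k : ℕ), k ∉ S → fill y f k = f k :=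
    fun y f k hk => if_neg hk
  have hrun : ∀ {H : Type} [Group H] (y : H) (f : ℕ → H) (x : H),
      run (fill y f) x u = run f x u :=
    fun y f x => run_congr (fun l hl => hnot y f _ (hu l hl)) x
  have hnat : ∀ {H K : Type} [Group H] [Group K] (φ : H →* K) (y : H) (f : ℕ → H),
      fill (φ y) (φ ∘ f) = φ ∘ fill y f := by
    intro H K _ _ φ y f
    funext k
    by_cases hk : k ∈ S
    · simp [hmem, hk]
    · simp [hnot, hk]
  refine ⟨⟨fun c => (c.1, fill 1 c.2), fun φ c => ?_, fun c hc => ⟨?_, fun k hk => ?_⟩⟩,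
    ⟨fun c => (c.1, fill (run c.2 c.1 u) c.2), fun φ c => ?_, fun c hc => ⟨?_, fun k hk => ?_⟩⟩,
    fun c hc => Prod.ext rfl (funext fun k => ?_), fun c hc => Prod.ext rfl (funext fun k => ?_)⟩
  · have := hnat φ 1 c.2
    rw [map_one] at this
    exact Prod.ext rfl this
  · exact ((hpath _ _).1 hc.path).2.congr fun l hl => (hnot _ _ _ (hw' l hl)).symm
  · by_cases hkS : k ∈ S
    · exact hmem _ _ _ hkS
    · exact (hnot _ _ _ hkS).trans (hc.eq_one k fun h => hk (((hover k).1 h).resolve_left hkS))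
  · refine Prod.ext rfl ?_
    have := hnat φ (run c.2 c.1 u) c.2
    rw [map_run] at this
    exact this
  · refine (hpath _ _).2 ⟨fun k hk => ?_, hc.path.congr fun l hl => (hnot _ _ _ (hw' l hl)).symm⟩
    exact (hmem _ _ _ hk).trans (hrun _ _ _).symm
  · have h := not_or.1 ((hover k).not.1 hk)
    exact (hnot _ _ _ h.1).trans (hc.eq_one k h.2)
  · by_cases hk : k ∈ S
    · refine (hmem _ _ _ hk).trans ?_
      exact (hrun _ _ _).trans (((hpath _ _).1 hc.path).1 k hk).symm
    · exact (hnot _ _ _ hk).trans (hnot _ _ _ hk)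
  · by_cases hk : k ∈ S
    · refine (hmem _ _ _ hk).trans (hc.eq_one k ?_).symm
      rintro ⟨l, hl, -, rfl⟩
      exact hw' l hl hk
    · exact (hnot _ _ _ hk).trans (hnot _ _ _ hk)

theorem zpow_conj_self {G : Type*} [Group G] (x : G) (n : ℤ) : x ^ n * x * x ^ (-n) = x := by
  rw [zpow_neg, mul_inv_eq_iff_eq_mul, (Commute.zpow_self x n).eq]

theorem ColoringEquivalent.kink (l : Letter) (u : List Letter)
    (hw : IsGaussWord ([l, l.opposite] ++ u)) :
    ColoringEquivalent ([l, l.opposite] ++ u) u := by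
  have hu : ∀ m ∈ u, m.label ≠ l.label := fun m hm => hw.label_ne (by simp) (by simp) hm
  obtain ⟨k, p, s⟩ := l
  rcases p with _ | _ | _
  · refine .remove {k} [] (by simpa using hu) (by simp) (fun j => ?_) fun f x => ?_
    · simp [OverAt, Letter.opposite, Passage.dual, eq_comm]
    · simp only [Letter.opposite, Passage.dual, List.cons_append, List.nil_append, path_cons,
        Letter.act, reduceCtorEq, if_true, if_false]
      constructor
      · rintro ⟨h1, -, h2⟩
        obtain rfl := h1 trivial
        rw [zpow_conj_self] at h2
        simpa using h2
      · rintro ⟨h1, h2⟩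
        obtain rfl : f k = x := by simpa using h1
        rw [zpow_conj_self]
        simpa using h2
  · refine .remove {k} [] (by simpa using hu) (by simp) (fun j => ?_) fun f x => ?_
    · simp [OverAt, Letter.opposite, Passage.dual, eq_comm]
    · simp only [Letter.opposite, Passage.dual, List.cons_append, List.nil_append, path_cons,
        Letter.act, reduceCtorEq, if_true, if_false, false_imp_iff, true_and, true_imp_iff]
      have : f k = f k ^ (s : ℤ) * x * f k ^ (-(s : ℤ)) ↔ f k = x := by
        rw [zpow_neg, eq_mul_inv_iff_mul_eq, (Commute.self_zpow (f k) (s : ℤ)).eq]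
        exact mul_right_inj _
      constructor
      · rintro ⟨h1, h2⟩
        obtain rfl := this.1 h1
        rw [zpow_conj_self] at h2
        simpa using h2
      · rintro ⟨h1, h2⟩
        obtain rfl : f k = x := by simpa using h1
        rw [zpow_conj_self]
        simpa using h2
  · refine .remove ∅ [] (by simp) (by simp) (fun j => ?_) fun f x => ?_
    · simp [OverAt, Letter.opposite, Passage.dual]
    · simp [Letter.opposite, Passage.dual, Letter.act]

/-- The two strands of a bigon meet in the double points `a` and `b` with opposite signs, so the
two conjugations along the under strand cancel. Both orders of the double points on the second
strand are covered. -/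
theorem ColoringEquivalent.bigon (a b : ℕ) (p : Passage) (s : ℤˣ) (u v B : List Letter)
    (hB : B = [⟨a, p.dual, -s⟩, ⟨b, p.dual, s⟩] ∨ B = [⟨b, p.dual, s⟩, ⟨a, p.dual, -s⟩])
    (hw : IsGaussWord ([⟨a, p, s⟩, ⟨b, p, -s⟩] ++ u ++ B ++ v)) :
    ColoringEquivalent ([⟨a, p, s⟩, ⟨b, p, -s⟩] ++ u ++ B ++ v) (u ++ v) := by
  have hperm : (([⟨a, p, s⟩, ⟨b, p, -s⟩] : List Letter) ++ u ++ B ++ v).Perm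
      ((([⟨a, p, s⟩, ⟨b, p, -s⟩] : List Letter) ++ B) ++ (u ++ v)) := by
    simp only [List.append_assoc]
    refine List.Perm.append_left _ ?_
    rw [← List.append_assoc, ← List.append_assoc]
    exact List.Perm.append_right _ List.perm_append_comm
  have hw' := hw.perm hperm
  have ha : ∀ m ∈ u ++ v, m.label ≠ a := fun m hm => hw'.label_ne (l := ⟨a, p, s⟩) (by simp)
    (by rcases hB with rfl | rfl <;> simp [Letter.opposite]) hm
  have hb : ∀ m ∈ u ++ v, m.label ≠ b := fun m hm => hw'.label_ne (l := ⟨b, p, -s⟩) (by simp)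
    (by rcases hB with rfl | rfl <;> simp [Letter.opposite]) hm
  have hab : ∀ m ∈ u ++ v, m.label ∉ ({a, b} : Finset ℕ) := by
    intro m hm
    simp [ha m hm, hb m hm]
  have habu : ∀ m ∈ u, m.label ∉ ({a, b} : Finset ℕ) := fun m hm =>
    hab m (List.mem_append_left _ hm)
  -- If the first strand is over, the colour of `a` and `b` is the initial one; if it is under, their
  -- colour is that of the second strand, which is reached after `u`.
  rcases p with _ | _ | _
  · refine .remove {a, b} [] hab (by simp) (fun j => ?_) fun f x => ?_
    · rw [OverAt.perm hperm]
      rcases hB with rfl | rfl <;>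
        simp [OverAt, Passage.dual, or_and_right, exists_or, or_assoc, eq_comm]
    · have key : f a = x → f b = x → ∀ y z, Path f y B z ↔ y = z := by
        intro ha hb y z
        rcases hB with rfl | rfl <;> simp [Passage.dual, Letter.act, ha, hb, mul_assoc]
      simp only [path_append, path_cons, path_nil, Letter.act]
      constructor
      · rintro ⟨z, ⟨z', ⟨z'', ⟨h1, h2, h3⟩, h4⟩, h5⟩, h6⟩
        simp at h1 h2 h3
        subst h3
        rw [key h1 h2] at h5
        subst h5
        simp [h1, h2]
        exact ⟨_, h4, h6⟩
      · rintro ⟨h1, z, h2, h3⟩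
        simp at h1
        refine ⟨z, ⟨z, ⟨x, ⟨fun _ => h1.1, fun _ => h1.2, rfl⟩, h2⟩, ?_⟩, h3⟩
        rw [key h1.1 h1.2]
  · refine .remove {a, b} u hab habu (fun j => ?_) fun f x => ?_
    · rw [OverAt.perm hperm]
      rcases hB with rfl | rfl <;>
        simp [OverAt, Passage.dual, or_and_right, exists_or, or_assoc, eq_comm, or_left_comm]
    · have key : ∀ y z, Path f y B z ↔ (f a = y ∧ f b = y) ∧ y = z := by
        intro y z
        rcases hB with rfl | rfl <;> simp [Passage.dual, Letter.act] <;> tauto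
      have key' : f a = f b → ∀ y z, Path f y [⟨a, .under, s⟩, ⟨b, .under, -s⟩] z ↔ y = z := by
        intro h y z
        simp [Letter.act, h, mul_assoc]
      simp only [path_append]
      constructor
      · rintro ⟨z, ⟨z', ⟨z'', h1, h2⟩, h3⟩, h4⟩
        rw [key] at h3
        obtain ⟨⟨h5, h6⟩, rfl⟩ := h3
        rw [key' (h5.trans h6.symm)] at h1
        subst h1
        refine ⟨?_, _, h2, h4⟩
        simp [h2.run_eq, h5, h6]
      · rintro ⟨h1, z, h2, h3⟩
        simp [h2.run_eq] at h1
        refine ⟨z, ⟨z, ⟨x, ?_, h2⟩, ?_⟩, h3⟩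
        · rw [key' (h1.1.trans h1.2.symm)]
        · rw [key]
          exact ⟨h1, rfl⟩
  · refine .remove ∅ [] (by simp) (by simp) (fun j => ?_) fun f x => ?_
    · rw [OverAt.perm hperm]
      rcases hB with rfl | rfl <;> simp [OverAt, Passage.dual]
    · have key : ∀ y z, Path f y B z ↔ y = z := by
        intro y z
        rcases hB with rfl | rfl <;> simp [Passage.dual, Letter.act]
      simp [path_append, key, Letter.act]

/-! ### Colourings under triangle moves -/

/-- The colours after the crossing `t` is conjugated by a power of that of the crossing `s`. -/
def conjColor {H : Type} [Group H] (s t : ℕ) (e : ℤ) (f : ℕ → H) : ℕ → H :=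
  Function.update f t (f s ^ e * f t * f s ^ (-e))

/-- The parts of the strands 1, 2, 3 (indexed by `0, 1, 2`) that are involved in a triangle
move. -/
def triangleStrand (a b c : ℕ) (p q : Passage) (α β γ η : ℤˣ) : Fin 3 → List Letter :=
  ![ordered (η * α * β) ⟨a, p, α⟩ ⟨b, p, β⟩,
    ordered (η * α * γ) ⟨a, p.dual, -α⟩ ⟨c, q, γ⟩,
    ordered (η * β * γ) ⟨b, p.dual, -β⟩ ⟨c, q.dual, -γ⟩]

/-- Each of the words `A i`, traversed with the colours `f`, may be replaced by `A' i`, traversed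
with the colours `f'`. -/
def Transfers {H : Type} [Group H] (f f' : ℕ → H) (A A' : Fin 3 → List Letter) : Prop :=
  ∀ i x y, Path f x (A i) y → Path f' x (A' i) y

/-- Strand 1 is over both others, so `a` and `b` have its colour. The over strand at `c` passes
under strand 1 either before or after `c`, and the move changes which, so the colour of `c` is
conjugated by that of `a`. -/
theorem transfers_over {H : Type} [Group H] (a b c : ℕ) (q : Passage) (hq : q ≠ .virt)
    (α β γ η : ℤˣ) (hac : a ≠ c) (hbc : b ≠ c) (f : ℕ → H) (x : H)
    (hx : ∃ y, Path f x (triangleStrand a b c .over q α β γ η 0) y) :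
    Transfers f (conjColor a c ((η * γ : ℤˣ) : ℤ) f) (triangleStrand a b c .over q α β γ η)
      (triangleStrand a b c .over q α β γ (-η)) := by
  have hab : f a = f b := by
    obtain ⟨y, hy⟩ := hx
    rcases Int.units_eq_one_or (η * α * β) with h | h <;>
    simp [triangleStrand, ordered, h, Letter.act] at hy <;> simp [hy]
  intro i x y
  rcases q with _ | _ | _
  · fin_cases i <;> rcases Int.units_eq_one_or α with rfl | rfl <;>
    rcases Int.units_eq_one_or β with rfl | rfl <;>
    rcases Int.units_eq_one_or γ with rfl | rfl <;>
    rcases Int.units_eq_one_or η with rfl | rfl <;>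
    simp [triangleStrand, ordered, Passage.dual, Letter.act, conjColor, hac, hbc, hab] <;>
    intros <;> subst_vars <;> simp_all [mul_assoc]
  · fin_cases i <;> rcases Int.units_eq_one_or α with rfl | rfl <;>
    rcases Int.units_eq_one_or β with rfl | rfl <;>
    rcases Int.units_eq_one_or γ with rfl | rfl <;>
    rcases Int.units_eq_one_or η with rfl | rfl <;>
    simp [triangleStrand, ordered, Passage.dual, Letter.act, conjColor, hac, hbc, hab] <;>
    intros <;> subst_vars <;> simp_all [mul_assoc]
  · exact absurd rfl hq

/-- Strand 2 is over both others, so `a` and `c` have its colour. Strand 3 passes over strand 1 at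
`b`, either before or after it passes under strand 2. -/
theorem transfers_under_over {H : Type} [Group H] (a b c : ℕ) (α β γ η : ℤˣ)
    (hab : a ≠ b) (hbc : b ≠ c) (f : ℕ → H) (x : H)
    (hx : ∃ y, Path f x (triangleStrand a b c .under .over α β γ η 1) y) :
    Transfers f (conjColor c b (-(η * β : ℤˣ) : ℤ) f)
      (triangleStrand a b c .under .over α β γ η)
      (triangleStrand a b c .under .over α β γ (-η)) := by
  have hac : f a = f c := by
    obtain ⟨y, hy⟩ := hx
    rcases Int.units_eq_one_or (η * α * γ) with h | h <;>
    simp [triangleStrand, ordered, h, Letter.act, Passage.dual] at hy <;> simp [hy]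
  intro i x y
  fin_cases i <;> rcases Int.units_eq_one_or α with rfl | rfl <;>
  rcases Int.units_eq_one_or β with rfl | rfl <;>
  rcases Int.units_eq_one_or γ with rfl | rfl <;>
  rcases Int.units_eq_one_or η with rfl | rfl <;>
  simp [triangleStrand, ordered, Passage.dual, Letter.act, conjColor, hab, hbc.symm, hac] <;>
  intros <;> subst_vars <;> simp_all [mul_assoc]

/-- Strand 3 is over both others, so `b` and `c` have its colour. Strand 2 passes over strand 1 at
`a`, either before or after it passes under strand 3. -/
theorem transfers_under_under {H : Type} [Group H] (a b c : ℕ) (α β γ η : ℤˣ)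
    (hab : a ≠ b) (hac : a ≠ c) (f : ℕ → H) (x : H)
    (hx : ∃ y, Path f x (triangleStrand a b c .under .under α β γ η 2) y) :
    Transfers f (conjColor c a ((η * α : ℤˣ) : ℤ) f)
      (triangleStrand a b c .under .under α β γ η)
      (triangleStrand a b c .under .under α β γ (-η)) := by
  have hbc : f b = f c := by
    obtain ⟨y, hy⟩ := hx
    rcases Int.units_eq_one_or (η * β * γ) with h | h <;>
    simp [triangleStrand, ordered, h, Letter.act, Passage.dual] at hy <;> simp [hy]
  intro i x y
  fin_cases i <;> rcases Int.units_eq_one_or α with rfl | rfl <;>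
  rcases Int.units_eq_one_or β with rfl | rfl <;>
  rcases Int.units_eq_one_or γ with rfl | rfl <;>
  rcases Int.units_eq_one_or η with rfl | rfl <;>
  simp [triangleStrand, ordered, Passage.dual, Letter.act, conjColor, hab.symm, hac.symm, hbc] <;>
  intros <;> subst_vars <;> simp_all [mul_assoc]

/-- Only the crossing `c` can be classical, and the colours there do not depend on the order in which
the strands meet it and the virtual crossings. -/
theorem transfers_virt {H : Type} [Group H] (a b c : ℕ) (q : Passage) (α β γ η : ℤˣ)
    (f : ℕ → H) :
    Transfers f f (triangleStrand a b c .virt q α β γ η)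
      (triangleStrand a b c .virt q α β γ (-η)) := by
  intro i x y
  rcases q with _ | _ | _ <;> fin_cases i <;>
  rcases Int.units_eq_one_or α with rfl | rfl <;>
  rcases Int.units_eq_one_or β with rfl | rfl <;>
  rcases Int.units_eq_one_or γ with rfl | rfl <;>
  rcases Int.units_eq_one_or η with rfl | rfl <;>
  simp +contextual [triangleStrand, ordered, Passage.dual, Letter.act]

/-- Strand 1 passes over a virtual crossing of the others: the colour of each strand changes at most
once and the over colours at `a` and `b` are that of strand 1, so the order is irrelevant. -/
theorem transfers_over_virt {H : Type} [Group H] (a b c : ℕ) (α β γ η : ℤˣ) (f : ℕ → H) :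
    Transfers f f (triangleStrand a b c .over .virt α β γ η)
      (triangleStrand a b c .over .virt α β γ (-η)) := by
  intro i x y
  fin_cases i <;>
  rcases Int.units_eq_one_or α with rfl | rfl <;>
  rcases Int.units_eq_one_or β with rfl | rfl <;>
  rcases Int.units_eq_one_or γ with rfl | rfl <;>
  rcases Int.units_eq_one_or η with rfl | rfl <;>
  simp +contextual [triangleStrand, ordered, Passage.dual, Letter.act]

/-- Conjugating the colours at the crossing `t` by a power of those at the crossing `s` is an
invertible transformation of colourings. -/
theorem ColoringEquivalent.conj {w w' : List Letter} (s t : ℕ) (e : ℤ) (hst : s ≠ t)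
    (hover : ∀ k, OverAt w k ↔ OverAt w' k) (ht : OverAt w t)
    (h : ∀ {H : Type} [Group H] (f : ℕ → H) (x : H),
      Path f x w x → Path (conjColor s t e f) x w' x)
    (h' : ∀ {H : Type} [Group H] (f : ℕ → H) (x : H),
      Path f x w' x → Path (conjColor s t (-e) f) x w x) :
    ColoringEquivalent w w' := by
  have hnat : ∀ (e : ℤ) {H K : Type} [Group H] [Group K] (φ : H →* K) (f : ℕ → H),
      conjColor s t e (φ ∘ f) = φ ∘ conjColor s t e f := by
    intro e H K _ _ φ f
    simp [conjColor, Function.comp_update]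
  have hne : ∀ (e : ℤ) {H : Type} [Group H] (f : ℕ → H) (k : ℕ), k ≠ t →
      conjColor s t e f k = f k := fun e H _ f k hk => Function.update_of_ne hk _ _
  have hinv : ∀ (e : ℤ) {H : Type} [Group H] (f : ℕ → H),
      conjColor s t (-e) (conjColor s t e f) = f := by
    intro e H _ f
    simp [conjColor, hst, mul_assoc]
  refine ⟨⟨fun c => (c.1, conjColor s t e c.2), fun φ c => Prod.ext rfl (hnat e φ c.2),
      fun c hc => ⟨h _ _ hc.path, fun k hk => ?_⟩⟩,
    ⟨fun c => (c.1, conjColor s t (-e) c.2), fun φ c => Prod.ext rfl (hnat (-e) φ c.2),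
      fun c hc => ⟨h' _ _ hc.path, fun k hk => ?_⟩⟩,
    fun c _ => Prod.ext rfl (hinv e c.2), fun c _ => Prod.ext rfl ?_⟩
  · rw [← hover] at hk
    exact (hne _ _ _ (by rintro rfl; exact hk ht)).trans (hc.eq_one k hk)
  · refine (hne _ _ _ (by rintro rfl; exact hk ht)).trans (hc.eq_one k ?_)
    rwa [← hover]
  · have := hinv (-e) c.2
    rwa [neg_neg] at this

theorem ColoringEquivalent.of_path_iff {w w' : List Letter}
    (hover : ∀ k, OverAt w k ↔ OverAt w' k)
    (h : ∀ {H : Type} [Group H] (f : ℕ → H) (x : H), Path f x w x ↔ Path f x w' x) :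
    ColoringEquivalent w w' :=
  ⟨⟨id, fun _ _ => rfl, fun _ hc => ⟨(h _ _).1 hc.path, fun k hk =>
      hc.eq_one k ((hover k).not.2 hk)⟩⟩,
    ⟨id, fun _ _ => rfl, fun _ hc => ⟨(h _ _).2 hc.path, fun k hk =>
      hc.eq_one k ((hover k).not.1 hk)⟩⟩, fun _ _ => rfl, fun _ _ => rfl⟩

theorem coe_ordered (s : ℤˣ) (l m : Letter) : (ordered s l m : Multiset Letter) = {l} + {m} := by
  unfold ordered
  split_ifs
  · rfl
  · rw [add_comm]; rfl

/-- The three strands of a triangle move inside a word; `i` and `j` are the strands that are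
traversed second and third. -/
def triangleWord (i j : Fin 3) (u v w : List Letter) (A : Fin 3 → List Letter) : List Letter :=
  A 0 ++ u ++ A i ++ v ++ A j ++ w

theorem Transfers.path_triangleWord {H : Type} [Group H] {f f' : ℕ → H}
    {A A' : Fin 3 → List Letter} (h : Transfers f f' A A') {i j : Fin 3} {u v w : List Letter}
    (hf : ∀ l ∈ u ++ v ++ w, f l.label = f' l.label) {x y : H}
    (hp : Path f x (triangleWord i j u v w A) y) : Path f' x (triangleWord i j u v w A') y := by
  simp only [triangleWord, path_append] at hp ⊢
  obtain ⟨z₁, ⟨z₂, ⟨z₃, ⟨z₄, ⟨z₅, h₁, h₂⟩, h₃⟩, h₄⟩, h₅⟩, h₆⟩ := hp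
  exact ⟨z₁, ⟨z₂, ⟨z₃, ⟨z₄, ⟨z₅, h _ _ _ h₁, h₂.congr fun l hl => hf l (by simp [hl])⟩,
    h _ _ _ h₃⟩, h₄.congr fun l hl => hf l (by simp [hl])⟩, h _ _ _ h₅⟩,
    h₆.congr fun l hl => hf l (by simp [hl])⟩

theorem Path.exists_of_triangleWord {H : Type} [Group H] {f : ℕ → H} {A : Fin 3 → List Letter}
    {i j : Fin 3} (hij : i = 1 ∧ j = 2 ∨ i = 2 ∧ j = 1) {u v w : List Letter} {x y : H}
    (hp : Path f x (triangleWord i j u v w A) y) (k : Fin 3) : ∃ x y, Path f x (A k) y := by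
  simp only [triangleWord, path_append] at hp
  obtain ⟨z₁, ⟨z₂, ⟨z₃, ⟨z₄, ⟨z₅, h₁, h₂⟩, h₃⟩, h₄⟩, h₅⟩, h₆⟩ := hp
  rcases hij with ⟨rfl, rfl⟩ | ⟨rfl, rfl⟩ <;> fin_cases k
  exacts [⟨_, _, h₁⟩, ⟨_, _, h₃⟩, ⟨_, _, h₅⟩, ⟨_, _, h₁⟩, ⟨_, _, h₅⟩, ⟨_, _, h₃⟩]

theorem triangleWord_perm (a b c : ℕ) (p q : Passage) (α β γ η : ℤˣ) {i j : Fin 3}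
    (hij : i = 1 ∧ j = 2 ∨ i = 2 ∧ j = 1) (u v w : List Letter) :
    (triangleWord i j u v w (triangleStrand a b c p q α β γ η)).Perm
      ([⟨a, p, α⟩, ⟨a, p.dual, -α⟩, ⟨b, p, β⟩, ⟨b, p.dual, -β⟩, ⟨c, q, γ⟩, ⟨c, q.dual, -γ⟩] ++
        (u ++ v ++ w)) := by
  rw [← Multiset.coe_eq_coe]
  rcases hij with ⟨rfl, rfl⟩ | ⟨rfl, rfl⟩ <;>
  simp only [triangleWord, triangleStrand, Matrix.cons_val, ← Multiset.coe_add, coe_ordered,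
    ← Multiset.cons_coe, ← Multiset.singleton_add, Multiset.coe_nil] <;> abel

/-- Triangle moves preserve colourings: at most the colour at one of the three double points is
conjugated, and that label occurs outside the triangle nowhere. -/
theorem ColoringEquivalent.triangle {t : Flavor} (a b c : ℕ) (p q : Passage) (α β γ η : ℤˣ)
    (h : TriangleAllowed t p q) {i j : Fin 3} (hij : i = 1 ∧ j = 2 ∨ i = 2 ∧ j = 1)
    (u v w : List Letter)
    (hw : IsGaussWord (triangleWord i j u v w (triangleStrand a b c p q α β γ η))) :
    ColoringEquivalent (triangleWord i j u v w (triangleStrand a b c p q α β γ η))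
      (triangleWord i j u v w (triangleStrand a b c p q α β γ (-η))) := by
  have hperm := fun η => triangleWord_perm a b c p q α β γ η hij u v w
  have hover : ∀ k, OverAt (triangleWord i j u v w (triangleStrand a b c p q α β γ η)) k ↔
      OverAt (triangleWord i j u v w (triangleStrand a b c p q α β γ (-η))) k :=
    OverAt.perm ((hperm η).trans (hperm (-η)).symm)
  have hw' := hw.perm (hperm η)
  have hR : ∀ l ∈ u ++ v ++ w, l.label ≠ a ∧ l.label ≠ b ∧ l.label ≠ c := by
    intro l hl
    exact ⟨hw'.label_ne (l := ⟨a, p, α⟩) (by simp) (by simp [Letter.opposite]) hl,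
      hw'.label_ne (l := ⟨b, p, β⟩) (by simp) (by simp [Letter.opposite]) hl,
      hw'.label_ne (l := ⟨c, q, γ⟩) (by simp) (by simp [Letter.opposite]) hl⟩
  have hab : a ≠ b := by
    have := IsGaussWord.label_ne (P := [⟨a, p, α⟩, ⟨a, p.dual, -α⟩])
      (R := [⟨b, p, β⟩, ⟨b, p.dual, -β⟩, ⟨c, q, γ⟩, ⟨c, q.dual, -γ⟩] ++ (u ++ v ++ w)) hw'
      (l := ⟨a, p, α⟩) (by simp) (by simp [Letter.opposite]) (m := ⟨b, p, β⟩) (by simp)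
    exact this.symm
  have hac : a ≠ c := by
    have := IsGaussWord.label_ne (P := [⟨a, p, α⟩, ⟨a, p.dual, -α⟩])
      (R := [⟨b, p, β⟩, ⟨b, p.dual, -β⟩, ⟨c, q, γ⟩, ⟨c, q.dual, -γ⟩] ++ (u ++ v ++ w)) hw'
      (l := ⟨a, p, α⟩) (by simp) (by simp [Letter.opposite]) (m := ⟨c, q, γ⟩) (by simp)
    exact this.symm
  have hbc : b ≠ c := by
    have := IsGaussWord.label_ne
      (P := [⟨a, p, α⟩, ⟨a, p.dual, -α⟩, ⟨b, p, β⟩, ⟨b, p.dual, -β⟩])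
      (R := [⟨c, q, γ⟩, ⟨c, q.dual, -γ⟩] ++ (u ++ v ++ w)) hw'
      (l := ⟨b, p, β⟩) (by simp) (by simp [Letter.opposite]) (m := ⟨c, q, γ⟩) (by simp)
    exact this.symm
  have hconj : ∀ {H : Type} [Group H] (s k : ℕ) (e : ℤ) (f : ℕ → H), k = a ∨ k = b ∨ k = c →
      ∀ l ∈ u ++ v ++ w, f l.label = conjColor s k e f l.label := by
    intro H _ s k e f hk l hl
    refine (Function.update_of_ne ?_ _ _).symm
    rcases hk with rfl | rfl | rfl
    exacts [(hR l hl).1, (hR l hl).2.1, (hR l hl).2.2]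
  have hmem : ∀ l : Letter, l ∈ ([⟨a, p, α⟩, ⟨a, p.dual, -α⟩, ⟨b, p, β⟩, ⟨b, p.dual, -β⟩,
      ⟨c, q, γ⟩, ⟨c, q.dual, -γ⟩] : List Letter) → l.passage = .over →
      OverAt (triangleWord i j u v w (triangleStrand a b c p q α β γ η)) l.label :=
    fun l hl ho => ⟨l, (hperm η).mem_iff.2 (List.mem_append_left _ hl), ho, rfl⟩
  -- If no colour changes, the claim follows from the corresponding local statement.
  have hsame : (∀ (η : ℤˣ) {H : Type} [Group H] (f : ℕ → H), Transfers f f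
        (triangleStrand a b c p q α β γ η) (triangleStrand a b c p q α β γ (-η))) →
      ColoringEquivalent (triangleWord i j u v w (triangleStrand a b c p q α β γ η))
        (triangleWord i j u v w (triangleStrand a b c p q α β γ (-η))) := by
    refine fun hT => .of_path_iff hover fun f x =>
      ⟨(hT η f).path_triangleWord fun _ _ => rfl, fun hp => ?_⟩
    have := (hT (-η) f).path_triangleWord (fun _ _ => rfl) hp
    rwa [neg_neg] at this
  rcases p with _ | _ | _
  · by_cases hq : q = .virt
    · subst hq
      exact hsame fun η H _ f => transfers_over_virt a b c α β γ η f
    · have key : ∀ (η : ℤˣ) {H : Type} [Group H] (f : ℕ → H) (x : H),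
          Path f x (triangleWord i j u v w (triangleStrand a b c .over q α β γ η)) x →
          Path (conjColor a c ((η * γ : ℤˣ) : ℤ) f) x
            (triangleWord i j u v w (triangleStrand a b c .over q α β γ (-η))) x := by
        intro η H _ f x hp
        obtain ⟨y, hy⟩ := hp.exists_of_triangleWord hij 0
        exact (transfers_over a b c q hq α β γ η hac hbc f y hy).path_triangleWord
          (hconj _ _ _ _ (by simp)) hp
      refine .conj a c ((η * γ : ℤˣ) : ℤ) hac hover ?_ (key η) fun f x hp => ?_
      · rcases q with _ | _ | _
        · exact hmem ⟨c, .over, γ⟩ (by simp) rfl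
        · exact hmem ⟨c, .over, -γ⟩ (by simp [Passage.dual]) rfl
        · exact absurd rfl hq
      · have := key (-η) f x hp
        rwa [neg_neg, neg_mul, Units.val_neg] at this
  · rcases q with _ | _ | _
    · have key : ∀ (η : ℤˣ) {H : Type} [Group H] (f : ℕ → H) (x : H),
          Path f x (triangleWord i j u v w (triangleStrand a b c .under .over α β γ η)) x →
          Path (conjColor c b (-(η * β : ℤˣ) : ℤ) f) x
            (triangleWord i j u v w (triangleStrand a b c .under .over α β γ (-η))) x := by
        intro η H _ f x hp
        obtain ⟨y, hy⟩ := hp.exists_of_triangleWord hij 1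
        exact (transfers_under_over a b c α β γ η hab hbc f y hy).path_triangleWord
          (hconj _ _ _ _ (by simp)) hp
      refine .conj c b (-(η * β : ℤˣ) : ℤ) hbc.symm hover
        (hmem ⟨b, .over, -β⟩ (by simp [Passage.dual]) rfl) (key η) fun f x hp => ?_
      have := key (-η) f x hp
      rwa [neg_neg, neg_mul, Units.val_neg] at this
    · have key : ∀ (η : ℤˣ) {H : Type} [Group H] (f : ℕ → H) (x : H),
          Path f x (triangleWord i j u v w (triangleStrand a b c .under .under α β γ η)) x →
          Path (conjColor c a ((η * α : ℤˣ) : ℤ) f) x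
            (triangleWord i j u v w (triangleStrand a b c .under .under α β γ (-η))) x := by
        intro η H _ f x hp
        obtain ⟨y, hy⟩ := hp.exists_of_triangleWord hij 2
        exact (transfers_under_under a b c α β γ η hab hac f y hy).path_triangleWord
          (hconj _ _ _ _ (by simp)) hp
      refine .conj c a ((η * α : ℤˣ) : ℤ) hac.symm hover
        (hmem ⟨a, .over, -α⟩ (by simp [Passage.dual]) rfl) (key η) fun f x hp => ?_
      have := key (-η) f x hp
      rwa [neg_neg, neg_mul, Units.val_neg] at this
    -- Moving a strand under a virtual crossing is not allowed.
    · simp [TriangleAllowed] at h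
  · exact hsame fun η H _ f => transfers_virt a b c q α β γ η f

/-! ### Invariance of the knot group and the bound for unknottable diagrams -/

theorem WordMove.coloringEquivalent {t : Flavor} {w w' : List Letter} (h : WordMove t w w')
    (hw : IsGaussWord w) : ColoringEquivalent w w' := by
  cases h with
  | rotate u v => exact .rotate u v
  | relabel f u => exact .relabel f _
  | kink l u => exact .kink l _ hw
  | bigonParallel a b p s u v => exact .bigon a b p s u v _ (Or.inl rfl) hw
  | bigonAntiparallel a b p s u v => exact .bigon a b p s u v _ (Or.inr rfl) hw
  | triangle a b c p q α β γ η u v w h =>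
    exact .triangle a b c p q α β γ η h (Or.inl ⟨rfl, rfl⟩) u v w hw
  | triangle' a b c p q α β γ η u v w h =>
    exact .triangle a b c p q α β γ η h (Or.inr ⟨rfl, rfl⟩) u v w hw

theorem Diagram.Move.nonempty_mulEquiv {t : Flavor} {D E : Diagram} (h : D.Move t E) :
    Nonempty (D.group ≃* E.group) := by
  obtain ⟨S, T, hTS, hST⟩ := WordMove.coloringEquivalent h D.isGaussWord
  exact Diagram.nonempty_mulEquiv S T hTS hST

/-- The knot group is an invariant of virtual and of welded knots. -/
theorem Diagram.nonempty_mulEquiv_of_knot_eq {t : Flavor} {D E : Diagram}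
    (h : D.knot t = E.knot t) : Nonempty (D.group ≃* E.group) := by
  replace h := Quot.eqvGen_exact h
  induction h with
  | rel D E h => exact h.nonempty_mulEquiv
  | refl D => exact ⟨MulEquiv.refl _⟩
  | symm D E _ ih => exact ih.map MulEquiv.symm
  | trans D E F _ _ ih₁ ih₂ =>
    obtain ⟨e₁⟩ := ih₁
    obtain ⟨e₂⟩ := ih₂
    exact ⟨e₁.trans e₂⟩

theorem Diagram.Unknottable.maQiuIndex_le {t : Flavor} {m n : ℕ} {D : Diagram}
    (h : D.Unknottable t m n) : maQiuIndex D.group ≤ (m : ℕ∞) + (n : ℕ∞) := by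
  induction h with
  | trivial D h =>
    obtain ⟨e⟩ := Diagram.nonempty_mulEquiv_of_knot_eq (E := Diagram.circle) h
    rw [maQiuIndex_congr e, maQiuIndex_circle]
    simp
  | virtualize m n D E h _ ih =>
    refine h.maQiuIndex_le.trans ((add_le_add_left ih 1).trans_eq ?_)
    push_cast
    exact add_right_comm _ _ _
  | change m n D E h _ ih =>
    refine h.maQiuIndex_le.trans ((add_le_add_left ih 1).trans_eq ?_)
    push_cast
    exact add_assoc _ _ _

end VirtualKnot

theorem mainTheorem6 (t : VirtualKnot.Flavor) (K : VirtualKnot.Knot t) (m n : ℕ)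
    (hK : ∃ D : VirtualKnot.Diagram, D.knot t = K ∧ D.Unknottable t m n)
    (E : VirtualKnot.Diagram) (hE : E.knot t = K) :
    VirtualKnot.nakanishiIndex E.group ≤ VirtualKnot.maQiuIndex E.group ∧
      VirtualKnot.maQiuIndex E.group ≤ (m : ℕ∞) + (n : ℕ∞) := by
  obtain ⟨D, hD, hu⟩ := hK
  obtain ⟨e⟩ := VirtualKnot.Diagram.nonempty_mulEquiv_of_knot_eq (hE.trans hD.symm)
  refine ⟨VirtualKnot.nakanishiIndex_le_maQiuIndex _, ?_⟩
  rw [VirtualKnot.maQiuIndex_congr e]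
  exact hu.maQiuIndex_le
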